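/- Let $G$ be a star on $k\ge 1$ vertices, that is, a graph with vertex set $V$, $|V|=k$, in which one vertex $c$ (the centre) is adjacent to all other vertices and there are no further edges. Choose an orientation of every edge of $G$, and let $\mathcal A_G$ be the automaton with alphabet $V$ whose states are the oriented edges $e=(x,y)$ of $G$ together with a sink $id$. The state $id$ fixes every word over $V$. The state $e=(x,y)$ acts on words over $V$ by $$e(xw)=y\,e(w),\qquad e(yw)=x\,w,\qquad e(zw)=z\,w\quad (z\in V\setminus\{x,y\}),$$ and fixes the empty word. For $n\ge 1$, let $\Gamma_n^G$ be the $n$-th Schreier graph of $\mathcal A_G$: its vertex set is $V^n$, and for every $u\in V^n$ and every state $q$ there is an edge, labelled by $q$, that joins $u$ and $q(u)$. For a finite connected graph $\Gamma$, let $W(\Gamma)$ be its Wiener index, that is, the sum of the distances $d_\Gamma(u,v)$ over all unordered pairs $\{u,v\}$ of vertices. Then, for every choice of the orientation and every $n\ge 1$, the graph $\Gamma_n^G$ is connected and $$W(\Gamma_n^G)=\frac{(k-1)^2(2k^2-2k-1)}{k^3(2k-1)}\cdot 2^n k^{2n}-\frac{(k-1)(k-2)}{k^2}\cdot k^{2n}+\frac{(k-1)(k-2)}{k^2(2k-1)}\cdot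 k^n .$$ -/

import Mathlib

namespace GraphAutomaton

/-- An invertible automaton with state set `Q` and alphabet `X`: a restriction map
`Q × X → Q` and an output map `Q × X → X` such that every state acts on the alphabet by a
permutation. -/
structure InvertibleAutomaton (Q X : Type*) where
  /-- the restriction map -/
  restr : Q → X → Q
  /-- the output map -/
  out : Q → Equiv.Perm X

namespace InvertibleAutomaton

variable {Q X : Type*} (A : InvertibleAutomaton Q X)

/-- The transformation of the words of length `n` defined by the state `q`: the first letter `x`
is replaced by the output of `q` at `x`, and the rest of the word is processed from the state
that is the restriction of `q` at `x`. -/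
def act : (n : ℕ) → Q → (Fin n → X) → (Fin n → X)
  | 0, _, w => w
  | n + 1, q, w => Fin.cons (A.out q (w 0)) (act n (A.restr q (w 0)) (Fin.tail w))

theorem act_bijective (n : ℕ) (q : Q) : Function.Bijective (A.act n q) := by
  induction n generalizing q with
  | zero => exact Function.bijective_id
  | succ n ih =>
    constructor
    · intro u v h
      have h' := Fin.cons_inj.mp h
      have h0 : u 0 = v 0 := (A.out q).injective h'.1
      have h1 : Fin.tail u = Fin.tail v := by
        have h2 := h'.2
        rw [h0] at h2
        exact (ih _).1 h2
      rw [← Fin.cons_self_tail u, ← Fin.cons_self_tail v, h0, h1]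
    · intro v
      obtain ⟨w, hw⟩ := (ih (A.restr q ((A.out q).symm (v 0)))).2 (Fin.tail v)
      refine ⟨Fin.cons ((A.out q).symm (v 0)) w, ?_⟩
      simp [act, hw]

/-- The permutation of the words of length `n` defined by a state. -/
noncomputable def actPerm (n : ℕ) (q : Q) : Equiv.Perm (Fin n → X) :=
  Equiv.ofBijective (A.act n q) (A.act_bijective n q)

/-- The `n`-th Schreier graph, with directions, labels, loops and multiple edges: its vertices are
the words of length `n`, and every state `q` and word `u` give an edge from `u` to `q(u)` that is
labelled by `q`. -/
abbrev LabelledSchreierGraph (n : ℕ) : Type _ :=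
  Quiver.SchreierGraph (Fin n → X) (A.actPerm n)

/-- The simple graph that underlies the `n`-th Schreier graph: directions, labels, loops and
multiplicities of edges, which are irrelevant for distances, are forgotten. -/
def schreierGraph (n : ℕ) : SimpleGraph (Fin n → X) :=
  SimpleGraph.fromRel fun u v =>
    Nonempty ((⟨u⟩ : A.LabelledSchreierGraph n) ⟶ (⟨v⟩ : A.LabelledSchreierGraph n))

end InvertibleAutomaton

/-- A choice of an orientation for every edge of `G`. -/
structure EdgeOrientation {V : Type*} (G : SimpleGraph V) where
  /-- the set of oriented edges -/
  arcs : Set (V × V)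
  adj_of_mem : ∀ x y, (x, y) ∈ arcs → G.Adj x y
  mem_or_mem : ∀ x y, G.Adj x y → (x, y) ∈ arcs ∨ (y, x) ∈ arcs
  not_both : ∀ x y, (x, y) ∈ arcs → (y, x) ∉ arcs

/-- The automaton of the graph `G` with the chosen orientation of its edges. Its alphabet is the
vertex set of `G`. Its states are the oriented edges and a sink `none`, which acts trivially. The
state `e = (x, y)` exchanges the letters `x` and `y` and fixes all others; its restriction at `x`
is `e`, and its restriction at any other letter is the sink. -/
def graphAutomaton {V : Type*} [DecidableEq V] {G : SimpleGraph V} (o : EdgeOrientation G) :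
    InvertibleAutomaton (Option o.arcs) V where
  restr
    | none, _ => none
    | some e, z => if z = e.1.1 then some e else none
  out
    | none => Equiv.refl V
    | some e => Equiv.swap e.1.1 e.1.2

/-- The Wiener index: the sum of the distances over all unordered pairs of vertices, that is,
half of the sum over all ordered pairs. -/
noncomputable def wienerIndex {V : Type*} [Fintype V] (G : SimpleGraph V) : ℚ :=
  (1 / 2) * ∑ u : V, ∑ v : V, (G.dist u v : ℚ)

end GraphAutomaton

/-!
Reading words from their first letter, `Γ_{n+1}` arises from `Γ_n` by subdividing every labelled
edge: the words that start with the centre are the old vertices, and a word `xw` is the new vertex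
on the edge at `w` that is labelled by the edge of the star at `x`. Loops become pendant edges and
double edges become squares, so all these graphs are connected and bipartite.

The distance of two new vertices involves the minimum of the four distances between the ends of
two edges. In a bipartite graph this minimum is the average of the four, up to constants, plus a
term that detects whether the two edges are in the Djoković–Winkler relation. The edges of `Γ_n`
that are not loops form cycles of even length (double edges being cycles of length two), where an
edge is related exactly to itself and to the opposite edge, so the sum of these terms is a multiple
of the number of edges. What remains is a linear recursion for the sum of all distances.
-/

namespace GraphAutomaton

section Distance

variable {W U : Type*} {G : SimpleGraph W} {G' : SimpleGraph U}

theorem le_add_dist_of_forall_adj_le (hG : G.Connected) {f : W → ℕ}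
    (hf : ∀ v w, G.Adj v w → f w ≤ f v + 1) (u v : W) : f v ≤ f u + G.dist u v := by
  obtain ⟨p, hp⟩ := hG.exists_walk_length_eq_dist u v
  rw [← hp]
  clear hp
  induction p with
  | nil => simp
  | cons h p ih =>
    have := hf _ _ h
    simp only [SimpleGraph.Walk.length_cons]
    omega

theorem dist_map_le_mul (hG : G.Connected) (hG' : G'.Connected) {φ : W → U} {m : ℕ}
    (hφ : ∀ u v, G.Adj u v → G'.dist (φ u) (φ v) ≤ m) (u v : W) :
    G'.dist (φ u) (φ v) ≤ m * G.dist u v := by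
  obtain ⟨p, hp⟩ := hG.exists_walk_length_eq_dist u v
  rw [← hp]
  clear hp
  induction p with
  | nil => simp
  | cons h p ih =>
    rw [SimpleGraph.Walk.length_cons, mul_add_one, add_comm]
    exact hG'.dist_triangle.trans (add_le_add (hφ _ _ h) ih)

theorem dist_iso (hG : G.Connected) (φ : G ≃g G') (u v : W) :
    G'.dist (φ u) (φ v) = G.dist u v := by
  have hG' : G'.Connected := φ.connected_iff.mp hG
  apply le_antisymm
  · simpa using dist_map_le_mul hG hG' (φ := φ) (m := 1)
      (fun u v h => (SimpleGraph.dist_eq_one_iff_adj.mpr (φ.map_rel_iff.mpr h)).le) u v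
  · simpa using dist_map_le_mul hG' hG (φ := φ.symm) (m := 1)
      (fun u v h => (SimpleGraph.dist_eq_one_iff_adj.mpr (φ.symm.map_rel_iff.mpr h)).le)
      (φ u) (φ v)

theorem dist_ne_of_adj_of_isBipartite (hG : G.Connected) (hb : G.IsBipartite) (u : W) {v w : W}
    (h : G.Adj v w) : G.dist u v ≠ G.dist u w := by
  intro heq
  let C : G.Coloring Bool := hb.toColoring (by simp)
  obtain ⟨p, hp⟩ := hG.exists_walk_length_eq_dist u v
  obtain ⟨q, hq⟩ := hG.exists_walk_length_eq_dist u w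
  have hp' := C.even_length_iff_congr p
  have hq' := C.even_length_iff_congr q
  rw [hp, heq, ← hq, hq'] at hp'
  have := C.valid h
  grind

theorem abs_dist_sub_dist_of_isBipartite [DecidableEq W] (hG : G.Connected) (hb : G.IsBipartite)
    (u : W) {v w : W} (h : v ≠ w → G.Adj v w) :
    |(G.dist u v : ℤ) - G.dist u w| = if v = w then 0 else 1 := by
  split_ifs with hvw
  · simp [hvw]
  · have hne := dist_ne_of_adj_of_isBipartite hG hb u (h hvw)
    have hcases := (h hvw).diff_dist_adj (u := u)
    grind

/-- The quantity that decides the Djoković–Winkler relation of the pairs `uu'` and `vv'`. For two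
edges of a bipartite graph it is `2` if they are related and `0` otherwise. -/
noncomputable def winkler (G : SimpleGraph W) (u u' v v' : W) : ℤ :=
  |(G.dist u v : ℤ) - G.dist u' v - G.dist u v' + G.dist u' v'|

theorem winkler_self_left (G : SimpleGraph W) (u v v' : W) : winkler G u u v v' = 0 := by
  simp [winkler]

theorem winkler_self_right (G : SimpleGraph W) (u u' v : W) : winkler G u u' v v = 0 := by
  simp [winkler]

theorem four_mul_min_dist [DecidableEq W] (hG : G.Connected) (hb : G.IsBipartite) {u u' v v' : W}
    (hu : u ≠ u' → G.Adj u u') (hv : v ≠ v' → G.Adj v v') :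
    4 * ((min (min (G.dist u v) (G.dist u' v)) (min (G.dist u v') (G.dist u' v')) : ℕ) : ℤ) =
      G.dist u v + G.dist u' v + G.dist u v' + G.dist u' v'
        - 2 * (if u = u' then 0 else 1) - 2 * (if v = v' then 0 else 1)
        + winkler G u u' v v' := by
  have h₁ := abs_dist_sub_dist_of_isBipartite hG hb v hu
  have h₂ := abs_dist_sub_dist_of_isBipartite hG hb v' hu
  have h₃ := abs_dist_sub_dist_of_isBipartite hG hb u hv
  have h₄ := abs_dist_sub_dist_of_isBipartite hG hb u' hv
  simp only [G.dist_comm (u := v), G.dist_comm (u := v')] at h₁ h₂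
  simp only [winkler, Int.abs_eq_natAbs] at *
  split_ifs at * <;> omega

end Distance

section PermGraph

variable {L W U : Type*}

/-- The Schreier graph of a family of permutations, without directions, labels, loops and
multiplicities of edges. -/
def permGraph (σ : L → Equiv.Perm W) : SimpleGraph W :=
  SimpleGraph.fromRel fun u v => ∃ x, σ x u = v

theorem permGraph_adj {σ : L → Equiv.Perm W} {u v : W} :
    (permGraph σ).Adj u v ↔ u ≠ v ∧ ∃ x, σ x u = v ∨ σ x v = u := by
  simp [permGraph, exists_or]

theorem permGraph_adj_apply {σ : L → Equiv.Perm W} {x : L} {u : W} (h : u ≠ σ x u) :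
    (permGraph σ).Adj u (σ x u) :=
  permGraph_adj.mpr ⟨h, x, .inl rfl⟩

theorem dist_apply_le_one (σ : L → Equiv.Perm W) (x : L) (u : W) :
    (permGraph σ).dist u (σ x u) ≤ 1 := by
  by_cases h : u = σ x u
  · simp [← h]
  · exact (SimpleGraph.dist_eq_one_iff_adj.mpr (permGraph_adj_apply h)).le

/-- Transport of the Schreier graph along a renaming of the vertices. -/
def permGraphIso (σ : L → Equiv.Perm W) (e : W ≃ U) :
    permGraph σ ≃g permGraph fun x => e.permCongr (σ x) where
  toEquiv := e
  map_rel_iff' := by simp [permGraph_adj]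

end PermGraph

section Subdivision

variable {L W : Type*} [DecidableEq L]

/-- The permutations whose Schreier graph is the subdivision of that of `σ`: the vertex
`(none, u)` is the old vertex `u`, and `(some x, u)` is the new vertex on the labelled edge from
`u` to `σ x u`. A loop is replaced by a pendant edge, and two parallel edges by a square. -/
def subdivide (σ : L → Equiv.Perm W) (x : L) : Equiv.Perm (Option L × W) :=
  Equiv.prodShear (Equiv.swap none (some x)) fun y => if y = some x then σ x else Equiv.refl W

variable {σ : L → Equiv.Perm W}

theorem subdivide_none (x : L) (u : W) : subdivide σ x (none, u) = (some x, u) := by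
  simp [subdivide]

theorem subdivide_some_self (x : L) (u : W) : subdivide σ x (some x, u) = (none, σ x u) := by
  simp [subdivide]

theorem subdivide_some_of_ne {x y : L} (h : y ≠ x) (u : W) :
    subdivide σ x (some y, u) = (some y, u) := by
  simp [subdivide, h, Equiv.swap_apply_of_ne_of_ne]

theorem permGraph_subdivide_adj_some_none {x : L} {u v : W} (hv : v = u ∨ v = σ x u) :
    (permGraph (subdivide σ)).Adj (some x, u) (none, v) := by
  rw [permGraph_adj]
  refine ⟨by simp, x, ?_⟩
  rcases hv with rfl | rfl
  · exact .inr (subdivide_none x v)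
  · exact .inl (subdivide_some_self x u)

theorem permGraph_subdivide_adj {p q : Option L × W} :
    (permGraph (subdivide σ)).Adj p q ↔ ∃ x u v, (v = u ∨ v = σ x u) ∧
      (p = (some x, u) ∧ q = (none, v) ∨ q = (some x, u) ∧ p = (none, v)) := by
  have apply_eq {p q : Option L × W} (hne : p ≠ q) {x : L} (h : subdivide σ x p = q) :
      ∃ x u v, (v = u ∨ v = σ x u) ∧
        (p = (some x, u) ∧ q = (none, v) ∨ q = (some x, u) ∧ p = (none, v)) := by
    subst h
    obtain ⟨_ | y, u⟩ := p
    · exact ⟨x, u, u, .inl rfl, .inr ⟨subdivide_none x u, rfl⟩⟩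
    · obtain rfl : y = x := by
        by_contra hyx
        exact hne (subdivide_some_of_ne hyx u).symm
      exact ⟨y, u, σ y u, .inr rfl, .inl ⟨rfl, subdivide_some_self y u⟩⟩
  constructor
  · rw [permGraph_adj]
    rintro ⟨hne, x, h | h⟩
    · exact apply_eq hne h
    · simpa only [or_comm (a := p = _ ∧ _)] using apply_eq hne.symm h
  · rintro ⟨x, u, v, hv, ⟨rfl, rfl⟩ | ⟨rfl, rfl⟩⟩
    · exact permGraph_subdivide_adj_some_none hv
    · exact (permGraph_subdivide_adj_some_none hv).symm

theorem isBipartite_permGraph_subdivide : (permGraph (subdivide σ)).IsBipartite := by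
  let C : (permGraph (subdivide σ)).Coloring Bool := .mk (fun p => p.1.isSome) <| by
    intro p q h
    obtain ⟨x, u, v, -, ⟨rfl, rfl⟩ | ⟨rfl, rfl⟩⟩ := permGraph_subdivide_adj.mp h <;>
      simp
  exact C.colorable

theorem reachable_permGraph_subdivide {u v : W} (h : (permGraph σ).Reachable u v) :
    (permGraph (subdivide σ)).Reachable (none, u) (none, v) := by
  obtain ⟨p⟩ := h
  induction p with
  | nil => rfl
  | @cons u w v h p ih =>
    refine .trans ?_ ih
    obtain ⟨-, x, rfl | rfl⟩ := permGraph_adj.mp h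
    · exact (permGraph_subdivide_adj_some_none (.inl rfl)).symm.reachable.trans
        (permGraph_subdivide_adj_some_none (.inr rfl)).reachable
    · exact (permGraph_subdivide_adj_some_none (.inr rfl)).symm.reachable.trans
        (permGraph_subdivide_adj_some_none (.inl rfl)).reachable

theorem connected_permGraph_subdivide (hσ : (permGraph σ).Connected) :
    (permGraph (subdivide σ)).Connected := by
  obtain ⟨u₀⟩ := hσ.nonempty
  refine SimpleGraph.connected_iff_exists_forall_reachable _ |>.mpr ⟨(none, u₀), ?_⟩
  rintro ⟨_ | x, u⟩
  · exact reachable_permGraph_subdivide (hσ u₀ u)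
  · exact (reachable_permGraph_subdivide (hσ u₀ u)).trans
      (permGraph_subdivide_adj_some_none (.inl rfl)).symm.reachable

/-- The distance in the subdivided graph, expressed by the distances of the old vertices. -/
noncomputable def subdivisionDist [DecidableEq W] (σ : L → Equiv.Perm W) :
    Option L × W → Option L × W → ℕ
  | (none, u), (none, v) => 2 * (permGraph σ).dist u v
  | (none, u), (some y, v) =>
    1 + 2 * min ((permGraph σ).dist u v) ((permGraph σ).dist u (σ y v))
  | (some x, u), (none, v) =>
    1 + 2 * min ((permGraph σ).dist u v) ((permGraph σ).dist (σ x u) v)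
  | (some x, u), (some y, v) =>
    if (x, u) = (y, v) then 0
    else 2 + 2 * min (min ((permGraph σ).dist u v) ((permGraph σ).dist (σ x u) v))
      (min ((permGraph σ).dist u (σ y v)) ((permGraph σ).dist (σ x u) (σ y v)))

theorem subdivisionDist_some_none_le [DecidableEq W] (hσ : (permGraph σ).Connected)
    (p : Option L × W) {y : L} {v w : W} (hw : w = v ∨ w = σ y v) :
    subdivisionDist σ p (some y, v) ≤ subdivisionDist σ p (none, w) + 1 ∧
      subdivisionDist σ p (none, w) ≤ subdivisionDist σ p (some y, v) + 1 := by
  have hstep : (permGraph σ).dist v (σ y v) ≤ 1 := dist_apply_le_one σ y v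
  have hstep' := (permGraph σ).dist_comm ▸ hstep
  have htri (u) := hσ.dist_triangle (u := u) (v := v) (w := σ y v)
  have htri' (u) := hσ.dist_triangle (u := u) (v := σ y v) (w := v)
  obtain ⟨_ | x, u⟩ := p
  · have h₁ := htri u
    have h₂ := htri' u
    simp only [subdivisionDist]
    rcases hw with rfl | rfl <;> omega
  · have h₁ := htri u
    have h₂ := htri' u
    have h₃ := htri (σ x u)
    have h₄ := htri' (σ x u)
    simp only [subdivisionDist]
    split_ifs with hxy
    · obtain ⟨rfl, rfl⟩ := Prod.mk_inj.mp hxy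
      rcases hw with rfl | rfl <;> simp
    · rcases hw with rfl | rfl <;> omega

theorem subdivisionDist_self [DecidableEq W] (p : Option L × W) : subdivisionDist σ p p = 0 := by
  obtain ⟨_ | x, u⟩ := p <;> simp [subdivisionDist]

theorem subdivisionDist_le_dist [DecidableEq W] (hσ : (permGraph σ).Connected)
    (p q : Option L × W) : subdivisionDist σ p q ≤ (permGraph (subdivide σ)).dist p q := by
  have hlip (q r : Option L × W) (h : (permGraph (subdivide σ)).Adj q r) :
      subdivisionDist σ p r ≤ subdivisionDist σ p q + 1 := by
    obtain ⟨y, v, w, hw, ⟨rfl, rfl⟩ | ⟨rfl, rfl⟩⟩ := permGraph_subdivide_adj.mp h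
    · exact (subdivisionDist_some_none_le hσ p hw).2
    · exact (subdivisionDist_some_none_le hσ p hw).1
  simpa [subdivisionDist_self] using
    le_add_dist_of_forall_adj_le (connected_permGraph_subdivide hσ) hlip p q

theorem dist_subdivide_none_none_le (hσ : (permGraph σ).Connected) (u v : W) :
    (permGraph (subdivide σ)).dist (none, u) (none, v) ≤ 2 * (permGraph σ).dist u v := by
  have hedge (x : L) (u : W) :
      (permGraph (subdivide σ)).dist (none, u) (none, σ x u) ≤ 2 :=
    SimpleGraph.dist_le <| .cons (permGraph_subdivide_adj_some_none (.inl rfl)).symm <|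
      .cons (permGraph_subdivide_adj_some_none (x := x) (.inr rfl)) .nil
  refine dist_map_le_mul hσ (connected_permGraph_subdivide hσ) (φ := fun u => (none, u))
    (fun u v h => ?_) u v
  obtain ⟨-, x, rfl | rfl⟩ := permGraph_adj.mp h
  · exact hedge x u
  · exact SimpleGraph.dist_comm ▸ hedge x v

theorem dist_subdivide_some_none_le (hσ : (permGraph σ).Connected) {x : L} {u u' : W}
    (hu : u' = u ∨ u' = σ x u) (v : W) :
    (permGraph (subdivide σ)).dist (some x, u) (none, v) ≤ 1 + 2 * (permGraph σ).dist u' v := by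
  have hadj := SimpleGraph.dist_eq_one_iff_adj.mpr (permGraph_subdivide_adj_some_none hu)
  calc _ ≤ _ := (connected_permGraph_subdivide hσ).dist_triangle (v := (none, u'))
    _ ≤ _ := add_le_add hadj.le (dist_subdivide_none_none_le hσ u' v)

theorem dist_subdivide_some_some_le (hσ : (permGraph σ).Connected) {x y : L} {u u' v v' : W}
    (hu : u' = u ∨ u' = σ x u) (hv : v' = v ∨ v' = σ y v) :
    (permGraph (subdivide σ)).dist (some x, u) (some y, v) ≤
      2 + 2 * (permGraph σ).dist u' v' := by
  have hadj := SimpleGraph.dist_eq_one_iff_adj.mpr (permGraph_subdivide_adj_some_none hv).symm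
  have htri := (connected_permGraph_subdivide hσ).dist_triangle (u := (some x, u))
    (v := (none, v')) (w := (some y, v))
  have := dist_subdivide_some_none_le hσ hu v'
  omega

theorem dist_subdivide [DecidableEq W] (hσ : (permGraph σ).Connected) (p q : Option L × W) :
    (permGraph (subdivide σ)).dist p q = subdivisionDist σ p q := by
  refine le_antisymm ?_ (subdivisionDist_le_dist hσ p q)
  obtain ⟨_ | x, u⟩ := p <;> obtain ⟨_ | y, v⟩ := q <;> simp only [subdivisionDist]
  · exact dist_subdivide_none_none_le hσ u v
  · have hle {v' : W} (hv : v' = v ∨ v' = σ y v) := dist_subdivide_some_none_le hσ hv u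
    have h₁ := hle (.inl rfl)
    have h₂ := hle (.inr rfl)
    simp only [SimpleGraph.dist_comm (v := u), SimpleGraph.dist_comm (v := (none, u))] at h₁ h₂
    omega
  · have hle {u' : W} (hu : u' = u ∨ u' = σ x u) := dist_subdivide_some_none_le hσ hu v
    have h₁ := hle (.inl rfl)
    have h₂ := hle (.inr rfl)
    omega
  · split_ifs with hxy
    · obtain ⟨rfl, rfl⟩ := Prod.mk_inj.mp hxy
      simp
    · have hle {u' v' : W} (hu : u' = u ∨ u' = σ x u) (hv : v' = v ∨ v' = σ y v) :=
        dist_subdivide_some_some_le hσ hu hv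
      have h₁ := hle (.inl rfl) (.inl rfl)
      have h₂ := hle (.inr rfl) (.inl rfl)
      have h₃ := hle (.inl rfl) (.inr rfl)
      have h₄ := hle (.inr rfl) (.inr rfl)
      omega

theorem dist_subdivide_none_some [DecidableEq W] (hσ : (permGraph σ).Connected)
    (hb : (permGraph σ).IsBipartite) (u : W) (y : L) (v : W) :
    ((permGraph (subdivide σ)).dist (none, u) (some y, v) : ℤ) =
      1 + (permGraph σ).dist u v + (permGraph σ).dist u (σ y v)
        - if v = σ y v then 0 else 1 := by
  have h := abs_dist_sub_dist_of_isBipartite hσ hb u (permGraph_adj_apply (x := y) (u := v))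
  rw [Int.abs_eq_natAbs] at h
  rw [dist_subdivide hσ, subdivisionDist]
  split_ifs at * <;> omega

theorem two_mul_dist_subdivide_some_some [DecidableEq W] (hσ : (permGraph σ).Connected)
    (hb : (permGraph σ).IsBipartite) (x : L) (u : W) (y : L) (v : W) :
    2 * ((permGraph (subdivide σ)).dist (some x, u) (some y, v) : ℤ) =
      4 + (permGraph σ).dist u v + (permGraph σ).dist (σ x u) v
        + (permGraph σ).dist u (σ y v) + (permGraph σ).dist (σ x u) (σ y v)
        - 2 * (if u = σ x u then 0 else 1) - 2 * (if v = σ y v then 0 else 1)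
        + winkler (permGraph σ) u (σ x u) v (σ y v) - if (x, u) = (y, v) then 4 else 0 := by
  have h := four_mul_min_dist hσ hb (permGraph_adj_apply (x := x) (u := u))
    (permGraph_adj_apply (x := y) (u := v))
  rw [dist_subdivide hσ, subdivisionDist]
  by_cases hxy : (x, u) = (y, v)
  · obtain ⟨rfl, rfl⟩ := Prod.mk_inj.mp hxy
    simp only [SimpleGraph.dist_self, zero_min, if_true] at h ⊢
    push_cast at h ⊢
    linarith
  · rw [if_neg hxy, if_neg hxy]
    push_cast at h ⊢
    linarith

theorem sum_winkler_halves [DecidableEq W] (hσ : (permGraph σ).Connected)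
    (hb : (permGraph σ).IsBipartite) (x y : L) (u v : W) :
    winkler (permGraph (subdivide σ)) (none, u) (some x, u) (none, v) (some y, v)
      + winkler (permGraph (subdivide σ)) (none, u) (some x, u) (some y, v) (none, σ y v)
      + (winkler (permGraph (subdivide σ)) (some x, u) (none, σ x u) (none, v) (some y, v)
      + winkler (permGraph (subdivide σ)) (some x, u) (none, σ x u) (some y, v) (none, σ y v)) =
    2 * winkler (permGraph σ) u (σ x u) v (σ y v)
      + if (x, u) = (y, v) then 8 * (1 - if u = σ x u then 0 else 1) else 0 := by
  have h₁ := abs_dist_sub_dist_of_isBipartite hσ hb v (permGraph_adj_apply (x := x) (u := u))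
  have h₂ := abs_dist_sub_dist_of_isBipartite hσ hb (σ y v)
    (permGraph_adj_apply (x := x) (u := u))
  have h₃ := abs_dist_sub_dist_of_isBipartite hσ hb u (permGraph_adj_apply (x := y) (u := v))
  have h₄ := abs_dist_sub_dist_of_isBipartite hσ hb (σ x u)
    (permGraph_adj_apply (x := y) (u := v))
  simp only [SimpleGraph.dist_comm (u := v), SimpleGraph.dist_comm (u := σ y v)] at h₁ h₂
  have hx : (if u = σ x u then (0 : ℤ) else 1) ≤ 1 := by split_ifs <;> simp
  have hy : (if v = σ y v then (0 : ℤ) else 1) ≤ 1 := by split_ifs <;> simp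
  simp only [winkler, dist_subdivide hσ, subdivisionDist, Int.abs_eq_natAbs] at *
  by_cases hxy : (x, u) = (y, v)
  · obtain ⟨rfl, rfl⟩ := Prod.mk_inj.mp hxy
    have h₅ := SimpleGraph.dist_comm (G := permGraph σ) (u := σ x u) (v := u)
    simp only [SimpleGraph.dist_self, if_true] at *
    generalize (if u = σ x u then (0 : ℤ) else 1) = m at *
    omega
  · simp only [hxy, if_false] at *
    generalize (if u = σ x u then (0 : ℤ) else 1) = m at *
    generalize (if v = σ y v then (0 : ℤ) else 1) = m' at *
    omega

end Subdivision

section Sums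

variable {L W U : Type*} [Fintype W] [Fintype U]

/-- The sum of the distances over all ordered pairs of vertices, that is, twice the Wiener
index. -/
noncomputable def totalDist (G : SimpleGraph W) : ℤ := ∑ u, ∑ v, (G.dist u v : ℤ)

theorem wienerIndex_eq_totalDist_div (G : SimpleGraph W) : wienerIndex G = totalDist G / 2 := by
  simp only [wienerIndex, totalDist]
  push_cast
  ring

theorem totalDist_iso {G : SimpleGraph W} {G' : SimpleGraph U} (hG : G.Connected)
    (φ : G ≃g G') : totalDist G' = totalDist G := by
  simp only [totalDist, ← dist_iso hG φ]
  rw [← φ.toEquiv.sum_comp]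
  refine Finset.sum_congr rfl fun u _ => ?_
  rw [← φ.toEquiv.sum_comp]
  rfl

variable [Fintype L]

/-- The number of labelled edges of the Schreier graph of `σ` that are not loops. -/
def numProperEdges [DecidableEq W] (σ : L → Equiv.Perm W) : ℤ :=
  ∑ e : L × W, if e.2 = σ e.1 e.2 then 0 else 1

/-- The sum of `winkler` over all ordered pairs of labelled edges of the Schreier graph of `σ`. -/
noncomputable def totalWinkler (σ : L → Equiv.Perm W) : ℤ :=
  ∑ e : L × W, ∑ f : L × W, winkler (permGraph σ) e.2 (σ e.1 e.2) f.2 (σ f.1 f.2)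

theorem numProperEdges_permCongr [DecidableEq W] [DecidableEq U] (σ : L → Equiv.Perm W)
    (e : W ≃ U) : numProperEdges (fun x => e.permCongr (σ x)) = numProperEdges σ := by
  rw [numProperEdges, ← ((Equiv.refl L).prodCongr e).sum_comp]
  simp [numProperEdges]

theorem totalWinkler_permCongr {σ : L → Equiv.Perm W} (hσ : (permGraph σ).Connected)
    (e : W ≃ U) : totalWinkler (fun x => e.permCongr (σ x)) = totalWinkler σ := by
  have hdist (u v : W) : (permGraph fun x => e.permCongr (σ x)).dist (e u) (e v) =
      (permGraph σ).dist u v := dist_iso hσ (permGraphIso σ e) u v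
  simp only [totalWinkler, ← ((Equiv.refl L).prodCongr e).sum_comp]
  simp [winkler, hdist]

theorem sum_edge_source {R : Type*} [Semiring R] (f : W → R) :
    ∑ e : L × W, f e.2 = Fintype.card L * ∑ u, f u := by
  simp [Fintype.sum_prod_type]

theorem sum_edge_target {R : Type*} [Semiring R] (σ : L → Equiv.Perm W) (f : W → R) :
    ∑ e : L × W, f (σ e.1 e.2) = Fintype.card L * ∑ u, f u := by
  simp [Fintype.sum_prod_type, Equiv.sum_comp (σ _) f]

theorem sum_option_prod {M : Type*} [AddCommMonoid M] (f : Option L × W → M) :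
    ∑ p, f p = ∑ u, f (none, u) + ∑ e : L × W, f (some e.1, e.2) := by
  simp [Fintype.sum_prod_type, Fintype.sum_option]

variable [DecidableEq L] {σ : L → Equiv.Perm W}

theorem sum_edges_subdivide {M : Type*} [AddCommMonoid M] {g : L × (Option L × W) → M}
    (hg : ∀ x p, subdivide σ x p = p → g (x, p) = 0) :
    ∑ e, g e = ∑ e : L × W, (g (e.1, none, e.2) + g (e.1, some e.1, e.2)) := by
  rw [Fintype.sum_prod_type, Fintype.sum_prod_type]
  refine Finset.sum_congr rfl fun x _ => ?_
  rw [sum_option_prod, Finset.sum_add_distrib, Fintype.sum_prod_type]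
  congr 1
  exact Fintype.sum_eq_single x fun y hy =>
    Finset.sum_eq_zero fun u _ => hg x _ (subdivide_some_of_ne hy u)

variable [DecidableEq W]

theorem sum_dist_subdivide_none_some (hσ : (permGraph σ).Connected)
    (hb : (permGraph σ).IsBipartite) :
    ∑ u : W, ∑ f : L × W, ((permGraph (subdivide σ)).dist (none, u) (some f.1, f.2) : ℤ) =
      Fintype.card L * (Fintype.card W : ℤ) ^ 2 + 2 * Fintype.card L * totalDist (permGraph σ)
        - Fintype.card W * numProperEdges σ := by
  have hsource (u : W) := sum_edge_source (L := L) fun v => ((permGraph σ).dist u v : ℤ)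
  have htarget (u : W) := sum_edge_target σ fun v => ((permGraph σ).dist u v : ℤ)
  simp only [dist_subdivide_none_some hσ hb, Finset.sum_sub_distrib, Finset.sum_add_distrib,
    hsource, htarget, ← Finset.mul_sum, Finset.sum_const, Finset.card_univ, Fintype.card_prod,
    nsmul_eq_mul, totalDist, numProperEdges]
  push_cast
  ring

theorem sum_dist_subdivide_some_some (hσ : (permGraph σ).Connected)
    (hb : (permGraph σ).IsBipartite) :
    2 * ∑ e : L × W, ∑ f : L × W,
        ((permGraph (subdivide σ)).dist (some e.1, e.2) (some f.1, f.2) : ℤ) =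
      4 * (Fintype.card L : ℤ) ^ 2 * (Fintype.card W : ℤ) ^ 2
        + 4 * (Fintype.card L : ℤ) ^ 2 * totalDist (permGraph σ)
        - 4 * Fintype.card L * Fintype.card W * numProperEdges σ
        + totalWinkler σ - 4 * Fintype.card L * Fintype.card W := by
  have hsource (u : W) := sum_edge_source (L := L) fun v => ((permGraph σ).dist u v : ℤ)
  have htarget (u : W) := sum_edge_target σ fun v => ((permGraph σ).dist u v : ℤ)
  have hsource' := sum_edge_source (L := L) fun u => ∑ v, ((permGraph σ).dist u v : ℤ)
  have htarget' := sum_edge_target σ fun u => ∑ v, ((permGraph σ).dist u v : ℤ)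
  rw [Finset.mul_sum]
  simp only [Finset.mul_sum _ _ (2 : ℤ), two_mul_dist_subdivide_some_some hσ hb,
    Finset.sum_sub_distrib, Finset.sum_add_distrib]
  simp only [← Finset.mul_sum, hsource, htarget, hsource', htarget', Prod.mk.eta,
    Finset.sum_ite_eq, Finset.mem_univ, if_true, Finset.sum_const, Finset.card_univ,
    Fintype.card_prod, nsmul_eq_mul, totalDist, numProperEdges, totalWinkler]
  push_cast
  ring

theorem totalDist_subdivide (hσ : (permGraph σ).Connected) (hb : (permGraph σ).IsBipartite) :
    2 * totalDist (permGraph (subdivide σ)) =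
      4 * (Fintype.card L + 1 : ℤ) ^ 2 * totalDist (permGraph σ)
        + 4 * Fintype.card L * (Fintype.card L + 1) * (Fintype.card W : ℤ) ^ 2
        - 4 * (Fintype.card L + 1) * Fintype.card W * numProperEdges σ
        + totalWinkler σ - 4 * Fintype.card L * Fintype.card W := by
  have hnone : ∑ u : W, ∑ v : W, ((permGraph (subdivide σ)).dist (none, u) (none, v) : ℤ) =
      2 * totalDist (permGraph σ) := by
    simp [dist_subdivide hσ, subdivisionDist, totalDist, Finset.mul_sum]
  have hsymm : ∑ e : L × W, ∑ u : W,
      ((permGraph (subdivide σ)).dist (some e.1, e.2) (none, u) : ℤ) =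
      ∑ u : W, ∑ e : L × W, ((permGraph (subdivide σ)).dist (none, u) (some e.1, e.2) : ℤ) := by
    rw [Finset.sum_comm]
    simp only [SimpleGraph.dist_comm]
  rw [totalDist]
  simp only [sum_option_prod, Finset.sum_add_distrib]
  rw [hnone, hsymm]
  linear_combination 4 * sum_dist_subdivide_none_some hσ hb + sum_dist_subdivide_some_some hσ hb

theorem numProperEdges_subdivide :
    numProperEdges (subdivide σ) = 2 * Fintype.card L * Fintype.card W := by
  rw [numProperEdges, sum_edges_subdivide (σ := σ) fun x p h => if_pos h.symm]
  simp only [subdivide_none, subdivide_some_self, Prod.mk.injEq, reduceCtorEq, and_true, false_and,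
    if_false, Int.reduceAdd, Finset.sum_const, Finset.card_univ, Fintype.card_prod, nsmul_eq_mul,
    Nat.cast_mul]
  ring

theorem totalWinkler_subdivide (hσ : (permGraph σ).Connected)
    (hb : (permGraph σ).IsBipartite) :
    totalWinkler (subdivide σ) =
      2 * totalWinkler σ + 8 * (Fintype.card L * Fintype.card W - numProperEdges σ) := by
  have hright (e : L × (Option L × W)) := sum_edges_subdivide (σ := σ) (g := fun f =>
    winkler (permGraph (subdivide σ)) e.2 (subdivide σ e.1 e.2) f.2 (subdivide σ f.1 f.2))
    fun x p h => by rw [h, winkler_self_right]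
  rw [totalWinkler]
  simp only [hright]
  rw [sum_edges_subdivide (σ := σ) fun x p h => by simp [h, winkler_self_left]]
  simp only [← Finset.sum_add_distrib, subdivide_none, subdivide_some_self,
    sum_winkler_halves hσ hb]
  simp only [Prod.mk.eta, Finset.sum_add_distrib, Finset.sum_sub_distrib, Finset.sum_ite_eq,
    Finset.mem_univ, if_true, ← Finset.mul_sum, Finset.sum_const, Finset.card_univ,
    Fintype.card_prod, nsmul_eq_mul, Nat.cast_mul, totalWinkler, numProperEdges]
  ring

end Sums

section Balanced

variable {L W U : Type*} [Fintype L] [Fintype W] [DecidableEq W] [Fintype U] [DecidableEq U]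

/-- The class of families of permutations on which the recursion for the distance sum closes: the
Schreier graph is connected and bipartite, and `totalWinkler` is four times the number of edges.
The last equation holds in a cactus of even cycles (parallel edges being cycles of length two),
where an edge is related to itself and to the opposite edge of its cycle only. -/
structure IsWinklerBalanced (σ : L → Equiv.Perm W) : Prop where
  connected : (permGraph σ).Connected
  isBipartite : (permGraph σ).IsBipartite
  totalWinkler_eq : totalWinkler σ = 4 * numProperEdges σ

namespace IsWinklerBalanced

variable {σ : L → Equiv.Perm W}

theorem of_unique [Unique W] (σ : L → Equiv.Perm W) : IsWinklerBalanced σ where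
  connected := .of_subsingleton
  isBipartite := (SimpleGraph.colorable_one_iff.mpr (Subsingleton.elim _ _)).mono one_le_two
  totalWinkler_eq := by
    simp [totalWinkler, numProperEdges, Subsingleton.elim _ (default : W), winkler_self_left]

theorem permCongr (hσ : IsWinklerBalanced σ) (e : W ≃ U) :
    IsWinklerBalanced fun x => e.permCongr (σ x) where
  connected := (permGraphIso σ e).connected_iff.mp hσ.connected
  isBipartite := hσ.isBipartite.of_hom (permGraphIso σ e).symm.toHom
  totalWinkler_eq := by
    rw [totalWinkler_permCongr hσ.connected, numProperEdges_permCongr, hσ.totalWinkler_eq]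

variable [DecidableEq L]

protected theorem subdivide (hσ : IsWinklerBalanced σ) : IsWinklerBalanced (subdivide σ) where
  connected := connected_permGraph_subdivide hσ.connected
  isBipartite := isBipartite_permGraph_subdivide
  totalWinkler_eq := by
    rw [totalWinkler_subdivide hσ.connected hσ.isBipartite, hσ.totalWinkler_eq,
      numProperEdges_subdivide]
    ring

theorem totalDist_subdivide (hσ : IsWinklerBalanced σ) :
    totalDist (permGraph (subdivide σ)) =
      2 * (Fintype.card L + 1 : ℤ) ^ 2 * totalDist (permGraph σ)
        + 2 * Fintype.card L * (Fintype.card L + 1) * (Fintype.card W : ℤ) ^ 2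
        - 2 * (Fintype.card L + 1) * Fintype.card W * numProperEdges σ
        + 2 * numProperEdges σ - 2 * Fintype.card L * Fintype.card W := by
  linarith [GraphAutomaton.totalDist_subdivide hσ.connected hσ.isBipartite, hσ.totalWinkler_eq]

end IsWinklerBalanced

end Balanced

section Shift

variable {V : Type*} [DecidableEq V] {c : V}

/-- Words of length `n + 1` as vertices of a subdivision: the centre `c` is the letter `none`. -/
def wordEquiv (c : V) (n : ℕ) :
    Option {x : V // x ≠ c} × (Fin n → V) ≃ (Fin (n + 1) → V) :=
  ((Equiv.optionSubtypeNe c).prodCongr (Equiv.refl _)).trans (Fin.consEquiv fun _ => V)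

/-- The action of the arc `(x, c)` of the star on words, as iterated subdivision. -/
def shift (c : V) : (n : ℕ) → {x : V // x ≠ c} → Equiv.Perm (Fin n → V)
  | 0, _ => 1
  | n + 1, x => (wordEquiv c n).permCongr (subdivide (shift c n) x)

theorem shift_cons_self (x : {x : V // x ≠ c}) {n : ℕ} (w : Fin n → V) :
    shift c (n + 1) x (Fin.cons x.1 w) = Fin.cons c (shift c n x w) := by
  have h : Fin.cons x.1 w = wordEquiv c n (some x, w) := rfl
  rw [h, shift, Equiv.permCongr_apply, Equiv.symm_apply_apply, subdivide_some_self]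
  rfl

theorem shift_cons_center (x : {x : V // x ≠ c}) {n : ℕ} (w : Fin n → V) :
    shift c (n + 1) x (Fin.cons c w) = Fin.cons x.1 w := by
  have h : Fin.cons c w = wordEquiv c n (none, w) := rfl
  rw [h, shift, Equiv.permCongr_apply, Equiv.symm_apply_apply, subdivide_none]
  rfl

theorem shift_cons_of_ne {x : {x : V // x ≠ c}} {z : V} (hzx : z ≠ x.1) (hzc : z ≠ c) {n : ℕ}
    (w : Fin n → V) : shift c (n + 1) x (Fin.cons z w) = Fin.cons z w := by
  have h : Fin.cons z w = wordEquiv c n (some ⟨z, hzc⟩, w) := rfl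
  rw [h, shift, Equiv.permCongr_apply, Equiv.symm_apply_apply, subdivide_some_of_ne]
  exact fun h => hzx (congrArg Subtype.val h)

end Shift

section StarAutomaton

variable {V : Type*} [DecidableEq V] {c : V}

theorem schreierGraph_adj {Q X : Type*} {A : InvertibleAutomaton Q X} {n : ℕ} {u v : Fin n → X} :
    (A.schreierGraph n).Adj u v ↔ u ≠ v ∧ ∃ q, A.act n q u = v ∨ A.act n q v = u := by
  have nonempty_hom_iff (u v : Fin n → X) :
      Nonempty ((⟨u⟩ : A.LabelledSchreierGraph n) ⟶ (⟨v⟩ : A.LabelledSchreierGraph n)) ↔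
        ∃ q, A.act n q u = v :=
    ⟨fun ⟨q, hq⟩ => ⟨q, congrArg Quiver.SchreierGraph.toVertex hq⟩,
      fun ⟨q, hq⟩ => ⟨⟨q, congrArg Quiver.SchreierGraph.ofVertex hq⟩⟩⟩
  simp only [InvertibleAutomaton.schreierGraph, SimpleGraph.fromRel_adj, nonempty_hom_iff,
    exists_or]

theorem act_none {G : SimpleGraph V} (o : EdgeOrientation G) (n : ℕ) (w : Fin n → V) :
    (graphAutomaton o).act n none w = w := by
  induction n with
  | zero => rfl
  | succ n ih =>
    exact (congrArg (Fin.cons (α := fun _ => V) (w 0)) (ih (Fin.tail w))).trans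
      (Fin.cons_self_tail w)

theorem act_cons_fst {G : SimpleGraph V} (o : EdgeOrientation G) (e : o.arcs) {n : ℕ}
    (w : Fin n → V) :
    (graphAutomaton o).act (n + 1) (some e) (Fin.cons e.1.1 w) =
      Fin.cons e.1.2 ((graphAutomaton o).act n (some e) w) := by
  simp [InvertibleAutomaton.act, graphAutomaton]

theorem act_cons_of_ne {G : SimpleGraph V} (o : EdgeOrientation G) (e : o.arcs) {z : V}
    (hz : z ≠ e.1.1) {n : ℕ} (w : Fin n → V) :
    (graphAutomaton o).act (n + 1) (some e) (Fin.cons z w) =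
      Fin.cons (Equiv.swap e.1.1 e.1.2 z) w := by
  have h : (graphAutomaton o).restr (some e) z = none := if_neg hz
  simp only [InvertibleAutomaton.act, Fin.cons_zero, Fin.tail_cons, h, act_none]
  rfl

variable (o : EdgeOrientation (SimpleGraph.starGraph c))

theorem act_eq_shift (x : {x : V // x ≠ c}) (h : (x.1, c) ∈ o.arcs) (n : ℕ) (w : Fin n → V) :
    (graphAutomaton o).act n (some ⟨(x, c), h⟩) w = shift c n x w := by
  induction n with
  | zero => rfl
  | succ n ih =>
    cases w using Fin.consCases with
    | cons z w =>
      by_cases hzx : z = x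
      · subst hzx
        rw [shift_cons_self, ← ih]
        exact act_cons_fst o ⟨(x.1, c), h⟩ w
      · rw [act_cons_of_ne o ⟨(x.1, c), h⟩ hzx]
        by_cases hzc : z = c
        · rw [hzc, shift_cons_center, Equiv.swap_apply_right]
        · rw [shift_cons_of_ne hzx hzc, Equiv.swap_apply_of_ne_of_ne hzx hzc]

theorem act_shift (x : {x : V // x ≠ c}) (h : (c, x.1) ∈ o.arcs) (n : ℕ) (w : Fin n → V) :
    (graphAutomaton o).act n (some ⟨(c, x), h⟩) (shift c n x w) = w := by
  induction n with
  | zero => rfl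
  | succ n ih =>
    cases w using Fin.consCases with
    | cons z w =>
      by_cases hzx : z = x
      · subst hzx
        rw [shift_cons_self]
        refine (act_cons_fst o ⟨(c, x.1), h⟩ _).trans ?_
        rw [ih]
      · by_cases hzc : z = c
        · rw [hzc, shift_cons_center, act_cons_of_ne o ⟨(c, x.1), h⟩ x.2, Equiv.swap_apply_right]
        · rw [shift_cons_of_ne hzx hzc, act_cons_of_ne o ⟨(c, x.1), h⟩ hzc,
            Equiv.swap_apply_of_ne_of_ne hzc hzx]

theorem schreierGraph_eq_permGraph_shift (n : ℕ) :
    (graphAutomaton o).schreierGraph n = permGraph (shift c n) := by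
  have exists_shift {u v : Fin n → V} (hne : u ≠ v) {q : Option o.arcs}
      (hq : (graphAutomaton o).act n q u = v) : ∃ x, shift c n x u = v ∨ shift c n x v = u := by
    obtain _ | ⟨⟨y, z⟩, h⟩ := q
    · exact absurd ((act_none o n u).symm.trans hq) hne
    · obtain ⟨hyz, rfl | rfl⟩ := SimpleGraph.starGraph_adj.mp (o.adj_of_mem y z h)
      · obtain ⟨w, rfl⟩ := (shift y n ⟨z, hyz.symm⟩).surjective u
        exact ⟨⟨z, hyz.symm⟩, .inr (congrArg _ (hq.symm.trans (act_shift o ⟨z, hyz.symm⟩ h n w)))⟩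
      · exact ⟨⟨y, hyz⟩, .inl ((act_eq_shift o ⟨y, hyz⟩ h n u).symm.trans hq)⟩
  have exists_act (x : {x : V // x ≠ c}) (u : Fin n → V) :
      ∃ q, (graphAutomaton o).act n q u = shift c n x u ∨
        (graphAutomaton o).act n q (shift c n x u) = u := by
    rcases o.mem_or_mem x c (SimpleGraph.starGraph_adj.mpr ⟨x.2, .inr rfl⟩) with h | h
    · exact ⟨_, .inl (act_eq_shift o x h n u)⟩
    · exact ⟨_, .inr (act_shift o x h n u)⟩
  ext u v
  rw [schreierGraph_adj, permGraph_adj]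
  refine and_congr_right fun hne => ⟨?_, ?_⟩
  · rintro ⟨q, h | h⟩
    · exact exists_shift hne h
    · simpa only [or_comm] using exists_shift hne.symm h
  · rintro ⟨x, rfl | rfl⟩
    · exact exists_act x u
    · simpa only [or_comm] using exists_act x v

end StarAutomaton

section Recursion

variable {V : Type*} [Fintype V] [DecidableEq V] (c : V)

theorem isWinklerBalanced_shift (n : ℕ) : IsWinklerBalanced (shift c n) := by
  induction n with
  | zero => exact .of_unique _
  | succ n ih => exact ih.subdivide.permCongr (wordEquiv c n)

theorem card_ne_center : (Fintype.card {x : V // x ≠ c} : ℤ) = Fintype.card V - 1 := by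
  rw [← Fintype.card_congr (Equiv.optionSubtypeNe c), Fintype.card_option, Nat.cast_add_one,
    add_sub_cancel_right]

theorem numProperEdges_shift_succ (n : ℕ) :
    numProperEdges (shift c (n + 1)) =
      2 * ((Fintype.card V : ℤ) - 1) * (Fintype.card V : ℤ) ^ n := by
  have h : numProperEdges (shift c (n + 1)) = numProperEdges (subdivide (shift c n)) :=
    numProperEdges_permCongr _ (wordEquiv c n)
  rw [h, numProperEdges_subdivide, card_ne_center, Fintype.card_fun, Fintype.card_fin,
    Nat.cast_pow]

theorem totalDist_shift_succ (n : ℕ) :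
    totalDist (permGraph (shift c (n + 1))) =
      2 * (Fintype.card V : ℤ) ^ 2 * totalDist (permGraph (shift c n))
        + 2 * ((Fintype.card V : ℤ) - 1) * (Fintype.card V : ℤ) ^ (2 * n + 1)
        - 2 * (Fintype.card V : ℤ) ^ (n + 1) * numProperEdges (shift c n)
        + 2 * numProperEdges (shift c n)
        - 2 * ((Fintype.card V : ℤ) - 1) * (Fintype.card V : ℤ) ^ n := by
  have hn := isWinklerBalanced_shift c n
  have h : totalDist (permGraph (shift c (n + 1))) =
      totalDist (permGraph (subdivide (shift c n))) :=
    totalDist_iso hn.subdivide.connected (permGraphIso _ (wordEquiv c n))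
  rw [h, hn.totalDist_subdivide, card_ne_center, Fintype.card_fun, Fintype.card_fin, Nat.cast_pow]
  ring

theorem wienerIndex_permGraph_shift_succ (n : ℕ) {k : ℚ} (hk : (Fintype.card V : ℚ) = k) :
    wienerIndex (permGraph (shift c (n + 1))) =
      ((k - 1) ^ 2 * (2 * k ^ 2 - 2 * k - 1)) / (k ^ 3 * (2 * k - 1))
          * (2 ^ (n + 1) * k ^ (2 * (n + 1)))
        - ((k - 1) * (k - 2)) / k ^ 2 * k ^ (2 * (n + 1))
        + ((k - 1) * (k - 2)) / (k ^ 2 * (2 * k - 1)) * k ^ (n + 1) := by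
  have hcard : 1 ≤ Fintype.card V := Fintype.card_pos_iff.mpr ⟨c⟩
  have hk₁ : 1 ≤ k := by rw [← hk]; exact_mod_cast hcard
  have hk₀ : k ≠ 0 := by positivity
  have hk₂ : 2 * k - 1 ≠ 0 := by linarith
  have hrec (m : ℕ) := congrArg (Int.cast (R := ℚ)) (totalDist_shift_succ c m)
  have hedges (m : ℕ) := congrArg (Int.cast (R := ℚ)) (numProperEdges_shift_succ c m)
  push_cast [hk] at hrec hedges
  rw [wienerIndex_eq_totalDist_div]
  induction n with
  | zero =>
    have hdist : totalDist (permGraph (shift c 0)) = 0 := by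
      simp [totalDist, Subsingleton.elim _ (default : Fin 0 → V)]
    have hedges₀ : numProperEdges (shift c 0) = 0 := by
      simp [numProperEdges, shift]
    rw [hrec, hdist, hedges₀]
    field_simp
    push_cast
    ring
  | succ n ih =>
    rw [hrec, hedges]
    linear_combination (norm := skip) 2 * k ^ 2 * ih
    field_simp
    ring

end Recursion

end GraphAutomaton

theorem mainTheorem11 {V : Type*} [Fintype V] [DecidableEq V] (c : V)
    (o : GraphAutomaton.EdgeOrientation (SimpleGraph.starGraph c))
    (k : ℕ) (hk : Fintype.card V = k) (n : ℕ) (hn : 1 ≤ n) :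
    ((GraphAutomaton.graphAutomaton o).schreierGraph n).Connected ∧
      GraphAutomaton.wienerIndex ((GraphAutomaton.graphAutomaton o).schreierGraph n) =
        (((k : ℚ) - 1) ^ 2 * (2 * (k : ℚ) ^ 2 - 2 * (k : ℚ) - 1)) /
            ((k : ℚ) ^ 3 * (2 * (k : ℚ) - 1)) * (2 ^ n * (k : ℚ) ^ (2 * n))
          - (((k : ℚ) - 1) * ((k : ℚ) - 2)) / (k : ℚ) ^ 2 * (k : ℚ) ^ (2 * n)
          + (((k : ℚ) - 1) * ((k : ℚ) - 2)) / ((k : ℚ) ^ 2 * (2 * (k : ℚ) - 1)) *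
            (k : ℚ) ^ n := by
  rw [GraphAutomaton.schreierGraph_eq_permGraph_shift]
  refine ⟨(GraphAutomaton.isWinklerBalanced_shift c n).connected, ?_⟩
  obtain ⟨m, rfl⟩ := Nat.exists_eq_add_of_le' hn
  exact GraphAutomaton.wienerIndex_permGraph_shift_succ c m (congrArg Nat.cast hk)
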